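/- Let $b\ge 3$, $1\le s<b$, $m\ge 4b$ be integers, and put $r=2^b$ and $t=2b-s$. Let $z$ be an integer with $z\equiv m \pmod{2b-s}$ and $1\le z\le b$, and let $\ell$ be an integer with $$\frac{2^{m+s-1}-1}{2^{b-1}(2^{b}+1)}<\ell \le \frac{2^{m}-2^{2b-s}(2^z-1)-1}{2^{2b-s}-1}.$$ Then there is a partial $t$-spread $\{W_1,\dots,W_\ell\}$ of $\mathbb F_2^m$ of size $\ell$, that is, $\ell$ subspaces of dimension $t$ with $W_i\cap W_j=\{0\}$ for $i\ne j$. Call a $(s+t)\times r$ matrix $A=\binom{A_1}{A_2}$ over $\mathbb F_2$, with $A_1$ of size $s\times r$ and $A_2$ of size $t\times r$, a *desired matrix* if $2^t>r$, $t>s$, $A$ has rank $s+t$, any two columns of $A_2$ (at distinct positions) are linearly independent and, when $t\ge 3$, any four columns of $A$ (at distinct positions) are linearly independent. Let $A$ be any desired matrix of this size, $\{W_1,\dots,W_\ell\}$ any partial $t$-spread of $\mathbb F_2^m$ of size $\ell$, $G_{W_i}$ any $m\times t$ matrix whose columns form a basis of $W_i$, and $G_U$ any invertible $s\times s$ matrix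 over $\mathbb F_2$. Put $$G_{M_i}=\begin{pmatrix}G_U&0\\0&G_{W_i}\end{pmatrix},\qquad H_G^i=\bigl(\mathbf 0_{(s+m)\times 1},\ G_{M_i}A\bigr),\qquad H=\begin{pmatrix}H_1&\cdots&H_\ell\\ H_G^1&\cdots&H_G^\ell\end{pmatrix},$$ where $H_i$ is the $\ell\times(r+1)$ matrix whose $i$-th row is all-one and whose other rows are zero. Then the binary linear code $\mathcal C$ with parity check matrix $H$ has length $n=(r+1)\ell$, dimension $k=n-\ell-m-s$ and minimum distance $d\ge 6$. It is a locally repairable code with locality $r$: every coordinate $i$ has a set $R_i\not\ni i$ of at most $r$ coordinates with $c_i=\sum_{j\in R_i}c_j$ for all $c\in\mathcal C$. It has $\ell$ disjoint local repair groups: $\mathcal C^\perp$ contains $\ell$ vectors of weight $r+1$ with pairwise disjoint supports. And $\mathcal C$ is $k$-optimal: $2\le r\le \frac n2-2$ and $k$ is the largest integer not exceeding the upper bound for the dimension of binary linear LRCs with $d\geq 5$ and $2\le r\le\frac n2-2$, that is, $$k=\left\lfloor \frac{rn}{r+1}-\min\left\{\log_2\left(1+\frac{rn}{2}\right),\ \frac{rn}{(r+1)(r+2)}\right\}\right\rfloor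 .$$ -/

import Mathlib

namespace BinaryLRC

/-- A binary linear code whose coordinates are indexed by `ι`; its length is `Fintype.card ι`. -/
abbrev Code (ι : Type*) := Submodule (ZMod 2) (ι → ZMod 2)

section Codes

variable {ι : Type*} [Fintype ι]

/-- Minimum distance: the least Hamming weight of a nonzero codeword
(with value `0` for the zero code, so `1 ≤ minDist C` forces `C ≠ ⊥`). -/
noncomputable def minDist (C : Code ι) : ℕ :=
  sInf {w | ∃ c ∈ C, c ≠ 0 ∧ hammingNorm c = w}

/-- Every coordinate `i` has a recovery set `R ∌ i` with `|R| ≤ r` and `c i = ∑ j ∈ R, c j`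
for all codewords `c`. -/
def HasLocality (C : Code ι) (r : ℕ) : Prop :=
  ∀ i, ∃ R : Finset ι, i ∉ R ∧ R.card ≤ r ∧ ∀ c ∈ C, c i = ∑ j ∈ R, c j

/-- The dual code. -/
def dual (C : Code ι) : Set (ι → ZMod 2) :=
  {w | ∀ c ∈ C, w ⬝ᵥ c = 0}

/-- `ℓ = n / (r + 1)` disjoint local repair groups: `ℓ` dual codewords of weight `r + 1` whose
supports are pairwise disjoint. -/
def HasDisjointRepairGroups (C : Code ι) (r ℓ : ℕ) : Prop :=
  Fintype.card ι = (r + 1) * ℓ ∧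
  ∃ h : Fin ℓ → ι → ZMod 2,
    (∀ i, h i ∈ dual C) ∧ (∀ i, hammingNorm (h i) = r + 1) ∧
    ∀ i j, i ≠ j → Disjoint (Function.support (h i)) (Function.support (h j))

/-- The explicit upper bound
`r n / (r + 1) - min {log₂ (1 + r n / 2), r n / ((r + 1) (r + 2))}`
for the dimension of a binary linear code of length `n`, locality `r` and minimum distance at
least `5`, valid for `2 ≤ r ≤ n / 2 - 2`. -/
noncomputable def dimBound (n r : ℕ) : ℝ :=
  (r : ℝ) * n / (r + 1) -
    min (Real.logb 2 (1 + (r : ℝ) * n / 2)) ((r : ℝ) * n / ((r + 1) * (r + 2)))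

/-- `C` is a `k`-optimal binary linear LRC with locality `r`: the parameters lie in the range of
the bound `dimBound`, and the dimension is the largest integer not exceeding that bound. -/
structure IsKOptimal (C : Code ι) (r : ℕ) : Prop where
  locality : HasLocality C r
  five_le_minDist : 5 ≤ minDist C
  two_le : 2 ≤ r
  le_half : (r : ℝ) ≤ (Fintype.card ι : ℝ) / 2 - 2
  finrank_eq : (Module.finrank (ZMod 2) C : ℤ) = ⌊dimBound (Fintype.card ι) r⌋

end Codes

/-- A partial `t`-spread `W₁, …, W_ℓ` of `𝔽₂ᵐ`: subspaces of dimension `t` with pairwise trivial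
intersection. -/
structure IsPartialSpread {m ℓ : ℕ} (t : ℕ) (W : Fin ℓ → Submodule (ZMod 2) (Fin m → ZMod 2)) :
    Prop where
  finrank_eq : ∀ i, Module.finrank (ZMod 2) (W i) = t
  inf_eq_bot : ∀ i j, i ≠ j → W i ⊓ W j = ⊥

/-- A desired matrix `A = (A₁ ; A₂)` of size `(s + t) × r`, with `A₁` the upper `s` rows and `A₂`
the lower `t` rows. -/
structure IsDesired {s t r : ℕ} (A : Matrix (Fin s ⊕ Fin t) (Fin r) (ZMod 2)) : Prop where
  lt_two_pow : r < 2 ^ t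
  lt : s < t
  rank_eq : A.rank = s + t
  two_columns : ∀ j j', j ≠ j' →
    LinearIndependent (ZMod 2) ![A.toRows₂.col j, A.toRows₂.col j']
  four_columns : 3 ≤ t → ∀ f : Fin 4 ↪ Fin r,
    LinearIndependent (ZMod 2) (fun i => A.col (f i))

section Construction

variable {s t m ℓ r : ℕ}

/-- The `m × t` matrix whose columns are the vectors of a basis of the subspace `W`. -/
noncomputable def basisMatrix {W : Submodule (ZMod 2) (Fin m → ZMod 2)}
    (e : Module.Basis (Fin t) (ZMod 2) W) : Matrix (Fin m) (Fin t) (ZMod 2) :=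
  Matrix.of fun p j => (e j : Fin m → ZMod 2) p

/-- The block-diagonal matrix `G_M = diag(G_U, G_W)` of size `(s + m) × (s + t)`. -/
def blockMatrix (GU : Matrix (Fin s) (Fin s) (ZMod 2)) (GW : Matrix (Fin m) (Fin t) (ZMod 2)) :
    Matrix (Fin s ⊕ Fin m) (Fin s ⊕ Fin t) (ZMod 2) :=
  Matrix.fromBlocks GU 0 0 GW

/-- The matrix `H_G = (0, G_M * A)` of size `(s + m) × (r + 1)`; column `0` is zero. -/
def lowerBlock (GM : Matrix (Fin s ⊕ Fin m) (Fin s ⊕ Fin t) (ZMod 2))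
    (A : Matrix (Fin s ⊕ Fin t) (Fin r) (ZMod 2)) :
    Matrix (Fin s ⊕ Fin m) (Fin (r + 1)) (ZMod 2) :=
  Matrix.of fun p => Fin.cons 0 fun j => (GM * A) p j

/-- The parity check matrix made of `ℓ` column blocks of width `r + 1`; column `j` of block `i` is
indexed by `(i, j)`. The upper `ℓ` rows of block `i` have row `i` all-one and the others zero; the
lower rows of block `i` are `HG i`. -/
def parityCheck (HG : Fin ℓ → Matrix (Fin s ⊕ Fin m) (Fin (r + 1)) (ZMod 2)) :
    Matrix (Fin ℓ ⊕ (Fin s ⊕ Fin m)) (Fin ℓ × Fin (r + 1)) (ZMod 2) :=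
  Matrix.fromRows
    (Matrix.of fun i' c => if i' = c.1 then 1 else 0)
    (Matrix.of fun p c => HG c.1 p c.2)

/-- The binary code with the parity check matrix assembled from `G_U`, from bases `e i` of the
members `W i` of a partial spread, and from `A`. -/
noncomputable def spreadCode (GU : Matrix (Fin s) (Fin s) (ZMod 2))
    {W : Fin ℓ → Submodule (ZMod 2) (Fin m → ZMod 2)}
    (e : ∀ i, Module.Basis (Fin t) (ZMod 2) (W i))
    (A : Matrix (Fin s ⊕ Fin t) (Fin r) (ZMod 2)) : Code (Fin ℓ × Fin (r + 1)) :=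
  LinearMap.ker
    (parityCheck fun i => lowerBlock (blockMatrix GU (basisMatrix (e i))) A).mulVecLin

end Construction

end BinaryLRC

/-! Distance: the all-one rows force even weight on every block, so a nonzero codeword of weight
below 6 lives on one block with weight at most 4, or on two blocks with weight 2 each. One block
contradicts the independence of four columns of `A`; for two blocks, the trivial intersection of two
spread members kills each contribution separately and contradicts the independence of two columns of
`A₂` (`eq_zero_of_mem_spreadCode`).

Dimension: too many nonzero vectors lie in the spread members to fit in a hyperplane, so they span
`𝔽₂ᵐ`, and `H` has full row rank `ℓ + s + m` (`IsPartialSpread.iSup_eq_top`,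
`parityCheck_mulVec_surjective`).

Optimality: `rn/(r+1) = rℓ`, so the minimum in the bound must lie in `(m+s-1, m+s]`. The lower bound
on `ℓ` says exactly that the logarithm exceeds `m+s-1`; the upper bound on `ℓ` keeps it at most
`m+s`; the other term is far larger than `m+s-1` (`floor_dimBound`).

Existence: spreads grow from dimension `n` to `n + t` by adding `2ⁿ` graphs over the field with `2ⁿ`
elements. -/

namespace BinaryLRC

/-! ### Existence of large partial spreads -/

section Spread

variable {V U : Type*} [AddCommGroup V] [Module (ZMod 2) V] [AddCommGroup U]
  [Module (ZMod 2) U]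

/-- `V` contains `N` subspaces of dimension `t` with pairwise trivial intersection. -/
def HasPartialSpread (V : Type*) [AddCommGroup V] [Module (ZMod 2) V] (t N : ℕ) : Prop :=
  ∃ W : Fin N → Submodule (ZMod 2) V,
    (∀ i, Module.finrank (ZMod 2) (W i) = t) ∧ ∀ i j, i ≠ j → Disjoint (W i) (W j)

lemma HasPartialSpread.mono {t N N' : ℕ} (h : HasPartialSpread V t N) (hN : N' ≤ N) :
    HasPartialSpread V t N' := by
  obtain ⟨W, hW, hd⟩ := h
  refine ⟨fun i => W (Fin.castLE hN i), fun i => hW _, fun i j hij => hd _ _ ?_⟩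
  exact fun h => hij (Fin.castLE_injective hN h)

lemma HasPartialSpread.map {t N : ℕ} (h : HasPartialSpread V t N) (f : V ≃ₗ[ZMod 2] U) :
    HasPartialSpread U t N := by
  obtain ⟨W, hW, hd⟩ := h
  refine ⟨fun i => (W i).map (f : V →ₗ[ZMod 2] U), fun i => ?_, fun i j hij => ?_⟩
  · rw [← hW i]
    exact (f.submoduleMap (W i)).finrank_eq.symm
  · exact (Submodule.disjoint_map f.injective (hd i j hij))

/-- A partial spread of a field extension `K` of degree at least `t` extends to a partial spread
of `𝔽₂ᵗ × K` by the graphs of the maps `x ↦ a * g x`, `a : K`, with `g : 𝔽₂ᵗ → K` injective. -/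
lemma HasPartialSpread.prod {K : Type*} [Field K] [Algebra (ZMod 2) K] [Finite K] {t N : ℕ}
    (h : HasPartialSpread K t N) (ht : t ≤ Module.finrank (ZMod 2) K) :
    HasPartialSpread ((Fin t → ZMod 2) × K) t (Nat.card K + N) := by
  obtain ⟨W, hW, hd⟩ := h
  have : Module.Finite (ZMod 2) K := Module.Finite.of_finite
  obtain ⟨g, hg⟩ : ∃ g : (Fin t → ZMod 2) →ₗ[ZMod 2] K, Function.Injective g := by
    obtain ⟨f, hf⟩ := exists_linearIndependent_of_le_finrank ht
    exact ⟨Fintype.linearCombination (ZMod 2) f,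
      linearIndependent_iff_injective_fintypeLinearCombination.1 hf⟩
  let G : K → Submodule (ZMod 2) ((Fin t → ZMod 2) × K) := fun a =>
    LinearMap.range (LinearMap.prod LinearMap.id (LinearMap.mulLeft (ZMod 2) a ∘ₗ g))
  let W' : Fin N → Submodule (ZMod 2) ((Fin t → ZMod 2) × K) := fun i =>
    (W i).map (LinearMap.inr (ZMod 2) (Fin t → ZMod 2) K)
  have hG : ∀ a, Module.finrank (ZMod 2) (G a) = t := fun a => by
    rw [LinearMap.finrank_range_of_inj]
    · simp
    · exact fun x y hxy => congrArg Prod.fst hxy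
  have hW' : ∀ i, Module.finrank (ZMod 2) (W' i) = t := fun i => by
    exact (Submodule.equivMapOfInjective _ LinearMap.inr_injective (W i)).finrank_eq.symm.trans
      (hW i)
  have hGG : ∀ a a', a ≠ a' → Disjoint (G a) (G a') := fun a a' haa => by
    rw [Submodule.disjoint_def]
    rintro _ ⟨x, rfl⟩ ⟨y, hy⟩
    have h1 : y = x := congrArg Prod.fst hy
    have h2 : a' * g y = a * g x := congrArg Prod.snd hy
    subst h1
    -- Two distinct multipliers agree only at zero because `K` has no zero divisors.
    have h3 : g y = 0 := by
      by_contra h0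
      exact haa (mul_right_cancel₀ h0 h2).symm
    have h4 : y = 0 := hg (by simpa using h3)
    simp [h4]
  have hGW : ∀ a i, Disjoint (G a) (W' i) := fun a i => by
    rw [Submodule.disjoint_def]
    rintro _ ⟨x, rfl⟩ ⟨y, _, hy⟩
    have h1 : 0 = x := congrArg Prod.fst hy
    simp [← h1]
  have hWW : ∀ i j, i ≠ j → Disjoint (W' i) (W' j) := fun i j hij =>
    Submodule.disjoint_map LinearMap.inr_injective (hd i j hij)
  let E : Fin (Nat.card K + N) ≃ K ⊕ Fin N :=
    finSumFinEquiv.symm.trans (Equiv.sumCongr (Finite.equivFin K).symm (Equiv.refl _))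
  refine ⟨fun i => Sum.elim G W' (E i), fun i => ?_, fun i j hij => ?_⟩
  · beta_reduce
    rcases E i with a | k
    · exact hG a
    · exact hW' k
  · have hE : E i ≠ E j := fun h => hij (E.injective h)
    beta_reduce
    generalize E i = p at *
    generalize E j = q at *
    rcases p with a | k <;> rcases q with a' | k'
    · exact hGG _ _ fun h => hE (by rw [h])
    · exact hGW _ _
    · exact (hGW _ _).symm
    · exact hWW _ _ fun h => hE (by rw [h])

/-- Lower bound for the size of a partial `t`-spread of a space of dimension `q * t + z`. -/
lemma exists_hasPartialSpread (t z q : ℕ) (ht : 1 ≤ t) (hq : 1 ≤ q) :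
    ∃ N : ℕ, N * (2 ^ t - 1) + 2 ^ t * 2 ^ z + 1 = 2 ^ (q * t + z) + 2 ^ t ∧
      HasPartialSpread (Fin (q * t + z) → ZMod 2) t N := by
  have h2 : 1 ≤ 2 ^ t := Nat.one_le_two_pow
  induction q, hq using Nat.le_induction with
  | base =>
    refine ⟨1, ?_, ?_⟩
    · rw [one_mul, one_mul, pow_add]; omega
    · obtain ⟨f, hf⟩ := exists_linearIndependent_of_le_finrank (R := ZMod 2)
        (M := Fin (1 * t + z) → ZMod 2) (n := t) (by simp)
      refine ⟨fun _ => Submodule.span _ (Set.range f), fun _ => ?_,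
        fun i j hij => (hij (Subsingleton.elim i j)).elim⟩
      rw [finrank_span_eq_card hf, Fintype.card_fin]
  | succ q hq ih =>
    obtain ⟨N, hN, hs⟩ := ih
    set n := q * t + z with hn
    have hn0 : n ≠ 0 := by
      have : 1 ≤ q * t := Nat.mul_pos hq ht
      omega
    have : Fact (Nat.Prime 2) := ⟨Nat.prime_two⟩
    have hK : Module.finrank (ZMod 2) (GaloisField 2 n) = n := GaloisField.finrank 2 hn0
    have hcard : Nat.card (GaloisField 2 n) = 2 ^ n := GaloisField.card 2 n hn0
    have hs' : HasPartialSpread (GaloisField 2 n) t N :=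
      hs.map (LinearEquiv.ofFinrankEq _ _ (by simp [hK]))
    -- One graph for each of the `2 ^ n` field elements, besides the old members.
    refine ⟨2 ^ n + N, ?_, ?_⟩
    · have e : (q + 1) * t + z = n + t := by rw [hn]; ring
      rw [e, pow_add 2 n t, add_mul]
      have : 2 ^ n * (2 ^ t - 1) + 2 ^ n = 2 ^ n * 2 ^ t := by
        rw [← Nat.mul_succ]; congr 1; omega
      omega
    · have := hs'.prod (by rw [hK, hn]; nlinarith)
      rw [hcard] at this
      refine this.map (LinearEquiv.ofFinrankEq _ _ ?_)
      simp only [Module.finrank_prod, Module.finrank_fin_fun, hK, hn]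
      ring

end Spread

/-! ### Parity and weight of binary vectors -/

section Weights

lemma zmod_two_eq_ite (a : ZMod 2) : a = if a ≠ 0 then 1 else 0 := by
  revert a; decide

lemma natCast_hammingNorm {ι : Type*} [Fintype ι] (x : ι → ZMod 2) :
    (hammingNorm x : ZMod 2) = ∑ i, x i := by
  rw [hammingNorm, Finset.card_filter, Nat.cast_sum]
  refine Finset.sum_congr rfl fun i _ => ?_
  rw [zmod_two_eq_ite (x i)]
  split_ifs <;> simp_all

lemma even_hammingNorm {ι : Type*} [Fintype ι] {x : ι → ZMod 2} (h : ∑ i, x i = 0) :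
    Even (hammingNorm x) := by
  rw [← natCast_hammingNorm] at h
  exact (ZMod.natCast_eq_zero_iff_even).1 h

lemma hammingNorm_prod {ι κ : Type*} [Fintype ι] [Fintype κ] (c : ι × κ → ZMod 2) :
    hammingNorm c = ∑ i, hammingNorm fun j => c (i, j) := by
  simp only [hammingNorm, Finset.card_filter, Fintype.sum_prod_type]

lemma hammingNorm_succ_le {r : ℕ} (x : Fin (r + 1) → ZMod 2) :
    hammingNorm (fun j : Fin r => x j.succ) ≤ hammingNorm x := by
  simp only [hammingNorm, Finset.card_filter, Fin.sum_univ_succ]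
  omega

/-- Column 0 of each lower block is zero, so the lower rows do not see entry 0 of a block; parity
recovers it from the others. -/
lemma eq_zero_of_succ_eq_zero {r : ℕ} {x : Fin (r + 1) → ZMod 2} (h : ∑ j, x j = 0)
    (hx : (fun j : Fin r => x j.succ) = 0) : x = 0 := by
  have hx' : ∀ j : Fin r, x j.succ = 0 := fun j => congrFun hx j
  rw [Fin.sum_univ_succ, Finset.sum_eq_zero fun j _ => hx' j, add_zero] at h
  funext j
  exact Fin.cases h hx' j

/-- If any `k` columns of `A` are linearly independent then a nonzero kernel vector of `A` has
weight more than `k`. -/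
lemma eq_zero_of_hammingNorm_le {ρ : Type*} {k r : ℕ} (A : Matrix ρ (Fin r) (ZMod 2))
    (hk : k ≤ r) (hA : ∀ f : Fin k ↪ Fin r, LinearIndependent (ZMod 2) fun i => A.col (f i))
    {y : Fin r → ZMod 2} (hy : hammingNorm y ≤ k) (h0 : A.mulVec y = 0) : y = 0 := by
  -- The hypothesis concerns exactly `k` columns, so the support is padded to size `k`; this is
  -- where `k ≤ r` enters.
  obtain ⟨S, hyS, -, hS⟩ := Finset.exists_subsuperset_card_eq
    (Finset.subset_univ (Finset.univ.filter fun i => y i ≠ 0)) hy (by simpa using hk)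
  have hout : ∀ i ∉ S, y i = 0 := fun i hi => by
    by_contra h
    exact hi (hyS (by simpa using h))
  have hli := hA (S.orderEmbOfFin hS).toEmbedding
  rw [Fintype.linearIndependent_iff] at hli
  have hmap : Finset.univ.map (S.orderEmbOfFin hS).toEmbedding = S :=
    Finset.map_orderEmbOfFin_univ S hS
  have hsum : ∑ i, y ((S.orderEmbOfFin hS).toEmbedding i) •
      A.col ((S.orderEmbOfFin hS).toEmbedding i) = 0 := by
    rw [← Finset.sum_map Finset.univ (S.orderEmbOfFin hS).toEmbedding fun i => y i • A.col i,
      hmap, Finset.sum_subset (Finset.subset_univ S) fun i _ hi => by simp [hout i hi]]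
    funext p
    have := congrFun h0 p
    simpa [Matrix.mulVec, dotProduct, Finset.sum_apply, mul_comm] using this
  have hz := hli _ hsum
  funext i
  by_cases hi : i ∈ S
  · rw [← hmap, Finset.mem_map] at hi
    obtain ⟨a, -, rfl⟩ := hi
    exact hz a
  · exact hout i hi

end Weights

/-- The code must be nonzero: otherwise the infimum is over the empty set and equals `0`. -/
lemma le_minDist {ι : Type*} [Fintype ι] {C : Code ι} {d : ℕ} (hC : C ≠ ⊥)
    (h : ∀ c ∈ C, hammingNorm c < d → c = 0) : d ≤ minDist C := by
  obtain ⟨c, hc, h0⟩ := Submodule.exists_mem_ne_zero_of_ne_bot hC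
  refine le_csInf ⟨_, c, hc, h0, rfl⟩ ?_
  rintro _ ⟨x, hx, hx0, rfl⟩
  by_contra! hlt
  exact hx0 (h x hx hlt)

/-! ### Distance, locality and dimension of the spread code -/

section Construction

variable {s t m ℓ r : ℕ} {GU : Matrix (Fin s) (Fin s) (ZMod 2)}
  {W : Fin ℓ → Submodule (ZMod 2) (Fin m → ZMod 2)}
  {e : ∀ i, Module.Basis (Fin t) (ZMod 2) (W i)}
  {A : Matrix (Fin s ⊕ Fin t) (Fin r) (ZMod 2)}

lemma parityCheck_mulVec_inl
    (HG : Fin ℓ → Matrix (Fin s ⊕ Fin m) (Fin (r + 1)) (ZMod 2))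
    (c : Fin ℓ × Fin (r + 1) → ZMod 2) (i : Fin ℓ) :
    (parityCheck HG).mulVec c (Sum.inl i) = ∑ j, c (i, j) := by
  simp only [Matrix.mulVec, dotProduct, Fintype.sum_prod_type]
  rw [Fintype.sum_eq_single i fun k hk => by simp [parityCheck, hk.symm]]
  simp [parityCheck]

lemma parityCheck_mulVec_inr (GM : Fin ℓ → Matrix (Fin s ⊕ Fin m) (Fin s ⊕ Fin t) (ZMod 2))
    (A : Matrix (Fin s ⊕ Fin t) (Fin r) (ZMod 2)) (c : Fin ℓ × Fin (r + 1) → ZMod 2)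
    (p : Fin s ⊕ Fin m) :
    (parityCheck fun i => lowerBlock (GM i) A).mulVec c (Sum.inr p) =
      (∑ i, (GM i).mulVec (A.mulVec fun j => c (i, j.succ))) p := by
  simp only [Matrix.mulVec_mulVec, Finset.sum_apply]
  simp [parityCheck, lowerBlock, Matrix.mulVec, dotProduct, Fintype.sum_prod_type,
    Fin.sum_univ_succ]

lemma mem_spreadCode {c : Fin ℓ × Fin (r + 1) → ZMod 2} :
    c ∈ spreadCode GU e A ↔ (∀ i, ∑ j, c (i, j) = 0) ∧
      ∑ i, (blockMatrix GU (basisMatrix (e i))).mulVec (A.mulVec fun j => c (i, j.succ)) = 0 := by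
  rw [spreadCode, LinearMap.mem_ker, Matrix.mulVecLin_apply]
  constructor
  · intro h
    refine ⟨fun i => ?_, ?_⟩
    · rw [← parityCheck_mulVec_inl, h]; rfl
    · funext p
      rw [← parityCheck_mulVec_inr, h]; rfl
  · rintro ⟨h1, h2⟩
    funext p
    rcases p with i | p
    · rw [parityCheck_mulVec_inl, h1]; rfl
    · rw [parityCheck_mulVec_inr, h2]; rfl

lemma basisMatrix_mulVec {U : Submodule (ZMod 2) (Fin m → ZMod 2)}
    (f : Module.Basis (Fin t) (ZMod 2) U) (q : Fin t → ZMod 2) :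
    (basisMatrix f).mulVec q = (f.equivFun.symm q : Fin m → ZMod 2) := by
  funext p
  simp [basisMatrix, Matrix.mulVec, dotProduct, Module.Basis.equivFun_symm_apply, mul_comm]

lemma basisMatrix_mulVec_mem {U : Submodule (ZMod 2) (Fin m → ZMod 2)}
    (f : Module.Basis (Fin t) (ZMod 2) U) (q : Fin t → ZMod 2) :
    (basisMatrix f).mulVec q ∈ U := by
  rw [basisMatrix_mulVec]; exact Subtype.mem _

lemma basisMatrix_mulVec_eq_zero {U : Submodule (ZMod 2) (Fin m → ZMod 2)}
    (f : Module.Basis (Fin t) (ZMod 2) U) {q : Fin t → ZMod 2}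
    (h : (basisMatrix f).mulVec q = 0) : q = 0 := by
  rw [basisMatrix_mulVec, ZeroMemClass.coe_eq_zero] at h
  exact (LinearEquiv.map_eq_zero_iff _).1 h

lemma blockMatrix_mulVec (GW : Matrix (Fin m) (Fin t) (ZMod 2)) (x : Fin s ⊕ Fin t → ZMod 2) :
    (blockMatrix GU GW).mulVec x =
      Sum.elim (GU.mulVec (x ∘ Sum.inl)) (GW.mulVec (x ∘ Sum.inr)) := by
  simp [blockMatrix, Matrix.fromBlocks_mulVec]

lemma mulVec_comp_inr (A : Matrix (Fin s ⊕ Fin t) (Fin r) (ZMod 2)) (y : Fin r → ZMod 2) :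
    A.mulVec y ∘ Sum.inr = A.toRows₂.mulVec y := rfl

lemma mulVec_injective_of_col (hGU : LinearIndependent (ZMod 2) GU.col) :
    Function.Injective GU.mulVec :=
  Matrix.mulVec_injective_iff.2 hGU

lemma blockMatrix_mulVec_eq_zero (hGU : LinearIndependent (ZMod 2) GU.col)
    {U : Submodule (ZMod 2) (Fin m → ZMod 2)} (f : Module.Basis (Fin t) (ZMod 2) U)
    {x : Fin s ⊕ Fin t → ZMod 2} (h : (blockMatrix GU (basisMatrix f)).mulVec x = 0) : x = 0 := by
  rw [blockMatrix_mulVec] at h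
  have h1 : x ∘ Sum.inl = 0 := mulVec_injective_of_col hGU (by
    rw [Matrix.mulVec_zero]; funext p; exact congrFun h (Sum.inl p))
  have h2 : x ∘ Sum.inr = 0 := basisMatrix_mulVec_eq_zero f (by
    funext p; exact congrFun h (Sum.inr p))
  funext p
  rcases p with p | p
  · exact congrFun h1 p
  · exact congrFun h2 p

lemma IsDesired.eq_zero_of_toRows₂ (hA : IsDesired A) (hr : 2 ≤ r) {y : Fin r → ZMod 2}
    (hy : hammingNorm y ≤ 2) (h0 : A.toRows₂.mulVec y = 0) : y = 0 := by
  refine eq_zero_of_hammingNorm_le A.toRows₂ hr (fun f => ?_) hy h0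
  have := hA.two_columns (f 0) (f 1) (fun h => by simpa using f.injective h)
  convert this using 1
  funext i
  fin_cases i <;> rfl

/-- A codeword of weight at most five vanishes: its weight in each block is even, so it lives
on one block, where four columns of `A` are independent, or on two blocks with weight two on each,
where the trivial intersection of spread members reduces to two columns of `A₂`. -/
lemma eq_zero_of_mem_spreadCode (hA : IsDesired A) (ht : 3 ≤ t) (hr : 4 ≤ r)
    (hW : IsPartialSpread t W) (hGU : LinearIndependent (ZMod 2) GU.col)
    {c : Fin ℓ × Fin (r + 1) → ZMod 2} (hc : c ∈ spreadCode GU e A) (hw : hammingNorm c < 6) :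
    c = 0 := by
  obtain ⟨hsum, hlow⟩ := mem_spreadCode.1 hc
  rw [hammingNorm_prod] at hw
  let x : Fin ℓ → Fin (r + 1) → ZMod 2 := fun i j => c (i, j)
  let y : Fin ℓ → Fin r → ZMod 2 := fun i j => c (i, j.succ)
  have heven : ∀ i, Even (hammingNorm (x i)) := fun i => even_hammingNorm (hsum i)
  have hyx : ∀ i, hammingNorm (y i) ≤ hammingNorm (x i) := fun i => hammingNorm_succ_le (x i)
  have hy0 : ∀ i, y i = 0 → x i = 0 := fun i h => eq_zero_of_succ_eq_zero (hsum i) h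
  have hpos : ∀ i, x i ≠ 0 → 2 ≤ hammingNorm (x i) := fun i h => by
    have h1 : 0 < hammingNorm (x i) := hammingNorm_pos_iff.2 h
    obtain ⟨a, ha⟩ := heven i
    omega
  have hsub : ∀ S : Finset (Fin ℓ), ∑ i ∈ S, hammingNorm (x i) < 6 := fun S =>
    (Finset.sum_le_sum_of_subset (Finset.subset_univ S)).trans_lt hw
  suffices h : ∀ i, x i = 0 by
    funext p
    exact congrFun (h p.1) p.2
  by_contra! hne
  obtain ⟨i, hi⟩ := hne
  have hzero : ∀ k, x k = 0 →
      (blockMatrix GU (basisMatrix (e k))).mulVec (A.mulVec (y k)) = 0 := fun k hk => by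
    have : y k = 0 := by funext j; exact congrFun hk j.succ
    rw [this, Matrix.mulVec_zero, Matrix.mulVec_zero]
  by_cases hex : ∃ j, j ≠ i ∧ x j ≠ 0
  · obtain ⟨j, hji, hj⟩ := hex
    have hrest : ∀ k, k ≠ i ∧ k ≠ j → x k = 0 := by
      rintro k ⟨hki, hkj⟩
      by_contra hk
      -- Three nonzero blocks of even weight would already give weight 6.
      have h3 := hsub {i, j, k}
      rw [Finset.sum_insert (by simp [hji.symm, hki.symm]), Finset.sum_pair hkj.symm] at h3
      have := hpos i hi
      have := hpos j hj
      have := hpos k hk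
      omega
    have h2 := hsub {i, j}
    rw [Finset.sum_pair hji.symm] at h2
    have hi2 : hammingNorm (x i) ≤ 2 := by
      have := hpos j hj
      obtain ⟨a, ha⟩ := heven i
      omega
    change ∑ k, (blockMatrix GU (basisMatrix (e k))).mulVec (A.mulVec (y k)) = 0 at hlow
    rw [Fintype.sum_eq_add i j hji.symm fun k hk => hzero k (hrest k hk)] at hlow
    -- Only the lower `m` rows separate the blocks: the upper `s` rows use the same `GU` everywhere.
    -- Hence the condition on pairs of columns concerns `A₂` alone.
    have hlow' : (basisMatrix (e i)).mulVec (A.toRows₂.mulVec (y i)) +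
        (basisMatrix (e j)).mulVec (A.toRows₂.mulVec (y j)) = 0 := by
      funext p
      have := congrFun hlow (Sum.inr p)
      simpa only [blockMatrix_mulVec, mulVec_comp_inr, Pi.add_apply, Pi.zero_apply,
        Sum.elim_inr] using this
    have hmem : (basisMatrix (e i)).mulVec (A.toRows₂.mulVec (y i)) ∈ W i ⊓ W j := by
      refine ⟨basisMatrix_mulVec_mem _ _, ?_⟩
      rw [eq_neg_of_add_eq_zero_left hlow']
      exact (W j).neg_mem (basisMatrix_mulVec_mem _ _)
    rw [hW.inf_eq_bot i j hji.symm, Submodule.mem_bot] at hmem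
    exact hi (hy0 i (hA.eq_zero_of_toRows₂ (by omega) ((hyx i).trans hi2)
      (basisMatrix_mulVec_eq_zero _ hmem)))
  · push Not at hex
    change ∑ k, (blockMatrix GU (basisMatrix (e k))).mulVec (A.mulVec (y k)) = 0 at hlow
    rw [Fintype.sum_eq_single i fun k hk => hzero k (hex k hk)] at hlow
    have h1 := hsub {i}
    rw [Finset.sum_singleton] at h1
    have hi4 : hammingNorm (x i) ≤ 4 := by
      obtain ⟨a, ha⟩ := heven i
      omega
    exact hi (hy0 i (eq_zero_of_hammingNorm_le A hr (hA.four_columns ht) ((hyx i).trans hi4)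
      (blockMatrix_mulVec_eq_zero hGU _ hlow)))

lemma hasLocality_spreadCode : HasLocality (spreadCode GU e A) r := by
  rintro ⟨i, j⟩
  refine ⟨(Finset.univ.erase j).map ⟨Prod.mk i, Prod.mk_right_injective i⟩, by simp, by simp, ?_⟩
  intro c hc
  have h := (mem_spreadCode.1 hc).1 i
  rw [← Finset.add_sum_erase _ _ (Finset.mem_univ j)] at h
  rw [Finset.sum_map]
  simpa [CharTwo.neg_eq] using eq_neg_of_add_eq_zero_left h

lemma hasDisjointRepairGroups_spreadCode :
    HasDisjointRepairGroups (spreadCode GU e A) r ℓ := by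
  refine ⟨by simp [mul_comm], fun i p => if p.1 = i then 1 else 0, fun i c hc => ?_, fun i => ?_,
    fun i j hij => ?_⟩
  · refine Eq.trans ?_ ((mem_spreadCode.1 hc).1 i)
    simp only [dotProduct, Fintype.sum_prod_type]
    rw [Fintype.sum_eq_single i fun k hk => by simp [hk]]
    simp
  · rw [hammingNorm_prod, Fintype.sum_eq_single i fun k hk => by simp [hk, hammingNorm]]
    simp [hammingNorm]
  · rw [Set.disjoint_left]
    intro p hp hq
    simp only [Function.mem_support, ne_eq, ite_eq_right_iff, one_ne_zero, imp_false,
      not_not] at hp hq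
    exact hij (hp ▸ hq)

/-- The members of a partial spread lying in a proper subspace are few. -/
lemma IsPartialSpread.iSup_eq_top (hW : IsPartialSpread t W) (hm : 1 ≤ m)
    (hℓ : 2 ^ (m - 1) ≤ ℓ * (2 ^ t - 1)) : ⨆ i, W i = ⊤ := by
  classical
  by_contra hne
  set U := ⨆ i, W i with hU
  have hlt : Module.finrank (ZMod 2) U < m := by
    simpa using Submodule.finrank_lt hne
  have hcard : ∀ X : Submodule (ZMod 2) (Fin m → ZMod 2),
      (Finset.univ.filter (· ∈ X)).card = 2 ^ Module.finrank (ZMod 2) X := fun X => by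
    rw [← Fintype.card_subtype, Module.card_eq_pow_finrank (K := ZMod 2), ZMod.card]
  -- The sets of nonzero vectors of the members are disjoint, with `2 ^ (m - 1)` elements or more in
  -- total; a proper subspace has at most `2 ^ (m - 1) - 1` nonzero vectors.
  let S : Fin ℓ → Finset (Fin m → ZMod 2) := fun i => (Finset.univ.filter (· ∈ W i)).erase 0
  have hS : ∀ i, (S i).card = 2 ^ t - 1 := fun i => by
    rw [Finset.card_erase_of_mem (by simp), hcard, hW.finrank_eq]
  have hdisj : (Finset.univ.biUnion S).card = ℓ * (2 ^ t - 1) := by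
    rw [Finset.card_biUnion]
    · simp [hS]
    · intro i _ j _ hij
      rw [Function.onFun, Finset.disjoint_left]
      intro v hv hv'
      simp only [S, Finset.mem_erase, Finset.mem_filter, Finset.mem_univ, true_and] at hv hv'
      have : v ∈ W i ⊓ W j := ⟨hv.2, hv'.2⟩
      rw [hW.inf_eq_bot i j hij] at this
      exact hv.1 (by simpa using this)
  have hsub : Finset.univ.biUnion S ⊆ (Finset.univ.filter (· ∈ U)).erase 0 := by
    intro v hv
    simp only [S, Finset.mem_biUnion, Finset.mem_erase, Finset.mem_filter, Finset.mem_univ,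
      true_and] at hv ⊢
    obtain ⟨i, h0, hi⟩ := hv
    exact ⟨h0, hU ▸ Submodule.mem_iSup_of_mem i hi⟩
  have hle := Finset.card_le_card hsub
  rw [hdisj, Finset.card_erase_of_mem (by simp), hcard] at hle
  have h1 : 2 ^ Module.finrank (ZMod 2) U ≤ 2 ^ (m - 1) :=
    Nat.pow_le_pow_right (by norm_num) (by omega)
  have h2 : 1 ≤ 2 ^ Module.finrank (ZMod 2) U := Nat.one_le_two_pow
  omega

lemma exists_sum_basisMatrix (e : ∀ i, Module.Basis (Fin t) (ZMod 2) (W i))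
    (hW : ⨆ i, W i = ⊤) (v : Fin m → ZMod 2) :
    ∃ q : Fin ℓ → Fin t → ZMod 2, ∑ i, (basisMatrix (e i)).mulVec (q i) = v := by
  have hv : v ∈ ⨆ i, W i := hW ▸ Submodule.mem_top
  induction hv using Submodule.iSup_induction' with
  | mem i x hx =>
    refine ⟨Pi.single i ((e i).equivFun ⟨x, hx⟩), ?_⟩
    rw [Fintype.sum_eq_single i fun k hk => by simp [hk], Pi.single_eq_same, basisMatrix_mulVec]
    simp
  | zero => exact ⟨0, by simp⟩
  | add x y _ _ hx hy =>
    obtain ⟨q, rfl⟩ := hx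
    obtain ⟨q', rfl⟩ := hy
    exact ⟨q + q', by simp [Matrix.mulVec_add, Finset.sum_add_distrib]⟩

lemma mulVec_surjective_of_rank {ρ : Type*} [Fintype ρ] (A : Matrix ρ (Fin r) (ZMod 2))
    (h : A.rank = Fintype.card ρ) : Function.Surjective A.mulVec := by
  have : LinearMap.range A.mulVecLin = ⊤ :=
    Submodule.eq_top_of_finrank_eq (by rw [← Matrix.rank, h]; simp)
  exact LinearMap.range_eq_top.1 this

lemma parityCheck_mulVec_surjective (e : ∀ i, Module.Basis (Fin t) (ZMod 2) (W i))
    (hA : IsDesired A) (hW : ⨆ i, W i = ⊤) (hℓ : 0 < ℓ)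
    (hGU : LinearIndependent (ZMod 2) GU.col) :
    Function.Surjective (parityCheck fun i =>
      lowerBlock (blockMatrix GU (basisMatrix (e i))) A).mulVec := by
  intro v
  obtain ⟨q, hq⟩ := exists_sum_basisMatrix e hW fun p => v (Sum.inr (Sum.inr p))
  obtain ⟨u, hu⟩ := (Matrix.mulVec_surjective_iff_isUnit.2
    (Matrix.mulVec_injective_iff_isUnit.1 (mulVec_injective_of_col hGU)))
    fun p => v (Sum.inr (Sum.inl p))
  let i₀ : Fin ℓ := ⟨0, hℓ⟩
  -- The blocks' contributions to the `s` rows add up through the common `GU`, so a single block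
  -- `i₀` can carry that part of the target.
  choose y hy using fun i => mulVec_surjective_of_rank A (by simp [hA.rank_eq])
    (Sum.elim ((Pi.single i₀ u : Fin ℓ → Fin s → ZMod 2) i) (q i))
  -- Entry 0 of each block does not affect the lower rows and is free to fix the all-one row.
  refine ⟨fun p => (Fin.cons (v (Sum.inl p.1) - ∑ j, y p.1 j) (y p.1) :
    Fin (r + 1) → ZMod 2) p.2, ?_⟩
  funext p
  rcases p with i | p
  · rw [parityCheck_mulVec_inl, Fin.sum_univ_succ]
    simp
  · rw [parityCheck_mulVec_inr]
    simp only [Fin.cons_succ]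
    have hy' : ∀ i, A.mulVec (fun j => y i j) = _ := hy
    simp only [hy', blockMatrix_mulVec, Sum.elim_comp_inl, Sum.elim_comp_inr, Finset.sum_apply]
    rcases p with p | p
    · simp only [Sum.elim_inl]
      rw [Fintype.sum_eq_single i₀ fun k hk => by simp [hk], Pi.single_eq_same, hu]
    · simp only [Sum.elim_inr]
      rw [← Finset.sum_apply, hq]

lemma finrank_spreadCode (hA : IsDesired A) (hW : ⨆ i, W i = ⊤) (hℓ : 0 < ℓ)
    (hGU : LinearIndependent (ZMod 2) GU.col) :
    Module.finrank (ZMod 2) (spreadCode GU e A) + (ℓ + (s + m)) = ℓ * (r + 1) := by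
  have h := LinearMap.finrank_range_add_finrank_ker (parityCheck fun i =>
    lowerBlock (blockMatrix GU (basisMatrix (e i))) A).mulVecLin
  rw [LinearMap.range_eq_top.2 (parityCheck_mulVec_surjective e hA hW hℓ hGU), finrank_top] at h
  simp only [Module.finrank_fintype_fun_eq_card, Fintype.card_sum, Fintype.card_prod,
    Fintype.card_fin] at h
  rw [spreadCode]
  omega

end Construction

/-! ### The bound and its numerical conditions -/

lemma floor_dimBound {r ℓ N : ℕ} (h₁ : 2 ^ (N + 1) < 2 + r * (r + 1) * ℓ)
    (h₂ : 2 + r * (r + 1) * ℓ ≤ 2 ^ (N + 2)) (h₃ : N * (r + 2) < r * ℓ) :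
    ⌊dimBound (ℓ * (r + 1)) r⌋ = (r : ℤ) * ℓ - (N + 1) := by
  have hr : (0 : ℝ) ≤ r := Nat.cast_nonneg r
  have h₁' : (2 : ℝ) ^ (N + 1) < 2 + r * (r + 1) * ℓ := by exact_mod_cast h₁
  have h₂' : (2 : ℝ) + r * (r + 1) * ℓ ≤ 2 ^ (N + 2) := by exact_mod_cast h₂
  have h₃' : (N : ℝ) * (r + 2) < r * ℓ := by exact_mod_cast h₃
  have e₁ : (r : ℝ) * ((ℓ * (r + 1) : ℕ) : ℝ) / (r + 1) = r * ℓ := by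
    push_cast; field_simp
  have e₂ : (r : ℝ) * ((ℓ * (r + 1) : ℕ) : ℝ) / ((r + 1) * (r + 2)) = r * ℓ / (r + 2) := by
    push_cast; field_simp
  have hpos : (0 : ℝ) < 1 + r * ((ℓ * (r + 1) : ℕ) : ℝ) / 2 := by positivity
  have hlog₁ : (N : ℝ) < Real.logb 2 (1 + r * ((ℓ * (r + 1) : ℕ) : ℝ) / 2) := by
    rw [Real.lt_logb_iff_rpow_lt (by norm_num) hpos, Real.rpow_natCast]
    push_cast
    rw [pow_succ] at h₁'
    linarith
  have hlog₂ : Real.logb 2 (1 + r * ((ℓ * (r + 1) : ℕ) : ℝ) / 2) ≤ N + 1 := by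
    rw [Real.logb_le_iff_le_rpow (by norm_num) hpos, ← Nat.cast_add_one, Real.rpow_natCast]
    push_cast
    rw [pow_succ _ (N + 1)] at h₂'
    linarith
  have hdiv : (N : ℝ) < r * ℓ / (r + 2) := by
    rwa [lt_div_iff₀ (by positivity)]
  rw [Int.floor_eq_iff, dimBound, e₁, e₂]
  push_cast
  have hmin := lt_min hlog₁ hdiv
  have hmin' := (min_le_left _ (r * ℓ / ((r : ℝ) + 2))).trans hlog₂
  push_cast at hmin hmin'
  constructor <;> linarith

section Parameters

variable {b s m ℓ : ℕ}

/-- The lower bound on `ℓ`, cleared of denominators. -/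
lemma two_pow_le_of_div_lt
    (h : ((2 : ℝ) ^ (m + s - 1) - 1) / (2 ^ (b - 1) * (2 ^ b + 1)) < ℓ) :
    2 ^ (m + s - 1) ≤ 2 ^ (b - 1) * (2 ^ b + 1) * ℓ := by
  rw [div_lt_iff₀ (by positivity)] at h
  have hlt : (2 : ℝ) ^ (m + s - 1) < 2 ^ (b - 1) * (2 ^ b + 1) * ℓ + 1 := by linarith
  have : 2 ^ (m + s - 1) < 2 ^ (b - 1) * (2 ^ b + 1) * ℓ + 1 := by exact_mod_cast hlt
  omega

/-- The upper bound on `ℓ`, cleared of denominators. -/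
lemma mul_le_of_le_div {t z : ℕ} (ht : 1 ≤ t)
    (h : (ℓ : ℝ) ≤ ((2 : ℝ) ^ m - 2 ^ t * (2 ^ z - 1) - 1) / (2 ^ t - 1)) :
    ℓ * (2 ^ t - 1) + 2 ^ t * 2 ^ z + 1 ≤ 2 ^ m + 2 ^ t := by
  have h2 : 2 ≤ 2 ^ t := by simpa using Nat.pow_le_pow_right (n := 2) (by norm_num) ht
  have h2' : (2 : ℝ) ≤ 2 ^ t := by exact_mod_cast h2
  rw [le_div_iff₀ (by linarith)] at h
  have : ((ℓ * (2 ^ t - 1) + 2 ^ t * 2 ^ z + 1 : ℕ) : ℝ) ≤ ((2 ^ m + 2 ^ t : ℕ) : ℝ) := by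
    push_cast [Nat.cast_sub (show 1 ≤ 2 ^ t by omega)]
    linarith
  exact_mod_cast this

/-- A crude exponential lower bound, from `2 ^ (b - 1) * (2 ^ b + 1) ≤ 2 ^ (2 * b)`; it suffices
wherever `ℓ` only has to be large compared with `m + s`. -/
lemma two_pow_le_length (hb : 3 ≤ b) (hs₁ : 1 ≤ s) (hm : 4 * b ≤ m)
    (h : 2 ^ (m + s - 1) ≤ 2 ^ (b - 1) * (2 ^ b + 1) * ℓ) : 2 ^ (m + s - 1 - 2 * b) ≤ ℓ := by
  have h1 : 2 ^ (b - 1) * (2 ^ b + 1) ≤ 2 ^ (2 * b) := by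
    have e : 2 ^ (2 * b) = 2 ^ (b - 1) * 2 ^ (b + 1) := by rw [← pow_add]; congr 1; omega
    rw [e, pow_succ 2 b]
    have : 1 ≤ 2 ^ b := Nat.one_le_two_pow
    exact Nat.mul_le_mul_left _ (by omega)
  have h2 : 2 ^ (m + s - 1) = 2 ^ (2 * b) * 2 ^ (m + s - 1 - 2 * b) := by
    rw [← pow_add]; congr 1; omega
  have h3 := h.trans (Nat.mul_le_mul_right ℓ h1)
  rw [h2] at h3
  exact Nat.le_of_mul_le_mul_left h3 (by positivity)

lemma four_mul_lt_two_pow {y : ℕ} (hy : 6 ≤ y) : 4 * y < 2 ^ y := by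
  induction y, hy using Nat.le_induction with
  | base => norm_num
  | succ y hy ih => rw [pow_succ]; omega

/-- Makes the non-logarithmic term of the minimum exceed `m + s - 1`. -/
lemma mul_lt_two_pow_mul (hb : 3 ≤ b) (hs₁ : 1 ≤ s) (hm : 4 * b ≤ m)
    (hℓ : 2 ^ (m + s - 1 - 2 * b) ≤ ℓ) : (m + s - 1) * (2 ^ b + 2) < 2 ^ b * ℓ := by
  have h1 := four_mul_lt_two_pow (y := m + s - 1 - 2 * b) (by omega)
  have h2 : 2 ≤ 2 ^ b := by
    simpa using Nat.pow_le_pow_right (n := 2) (by norm_num) (show 1 ≤ b by omega)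
  -- With `y = m + s - 1 - 2 * b`, the hypothesis `4 * b ≤ m` gives `2 * b ≤ y`, so `2 * (m + s - 1)
  -- ≤ 4 * y < 2 ^ y ≤ ℓ`.
  have h3 : 2 * (m + s - 1) < ℓ := by omega
  calc (m + s - 1) * (2 ^ b + 2) ≤ (m + s - 1) * (2 ^ b * 2) := Nat.mul_le_mul_left _ (by omega)
    _ = 2 ^ b * (2 * (m + s - 1)) := by ring
    _ < 2 ^ b * ℓ := Nat.mul_lt_mul_of_pos_left h3 (by positivity)

/-- Supplies the count that makes the spread span. It rests on `2 ^ (b - 1) * (2 ^ b + 1) ≤ 2 ^ s *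
(2 ^ t - 1)` with `t = 2 * b - s`, the comparison that also drives `mul_add_two_le_two_pow`. -/
lemma two_pow_le_mul_of_lower (hb : 3 ≤ b) (hs : s < b) (hm : 4 * b ≤ m)
    (h : 2 ^ (m + s - 1) ≤ 2 ^ (b - 1) * (2 ^ b + 1) * ℓ) :
    2 ^ (m - 1) ≤ ℓ * (2 ^ (2 * b - s) - 1) := by
  have e1 : 2 ^ (m + s - 1) = 2 ^ s * 2 ^ (m - 1) := by rw [← pow_add]; congr 1; omega
  have h1 : 2 ^ (b - 1) * (2 ^ b + 1) ≤ 2 ^ s * (2 ^ (2 * b - s) - 1) := by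
    have e2 : 2 ^ s * 2 ^ (2 * b - s) = 2 ^ (b - 1) * 2 ^ b * 2 := by
      rw [← pow_add, ← pow_add, ← pow_succ]; congr 1; omega
    have h2 : 2 ^ s ≤ 2 ^ (b - 1) := Nat.pow_le_pow_right (by norm_num) (by omega)
    have h3 : 2 ≤ 2 ^ b := by
      simpa using Nat.pow_le_pow_right (n := 2) (by norm_num) (show 1 ≤ b by omega)
    have h4 := Nat.mul_le_mul_left (2 ^ (b - 1)) h3
    rw [Nat.mul_sub, e2, mul_add]
    omega
  rw [e1] at h
  refine Nat.le_of_mul_le_mul_left (h.trans ((Nat.mul_le_mul_right ℓ h1).trans_eq ?_))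
    (show 0 < 2 ^ s by positivity)
  ring

lemma mul_add_two_le_two_pow {z : ℕ} (hb : 3 ≤ b) (hs : s < b) (hz₁ : 1 ≤ z)
    (h : ℓ * (2 ^ (2 * b - s) - 1) + 2 ^ (2 * b - s) * 2 ^ z + 1 ≤ 2 ^ m + 2 ^ (2 * b - s)) :
    2 + 2 ^ b * (2 ^ b + 1) * ℓ ≤ 2 ^ (m + s + 1) := by
  set T := 2 ^ (2 * b - s) with hT
  set B := 2 ^ (b - 1) with hB
  have hS : 2 ^ s ≤ B := Nat.pow_le_pow_right (by norm_num) (by omega)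
  have eb : 2 ^ b = 2 * B := by rw [hB, ← pow_succ']; congr 1; omega
  have hTS : T * 2 ^ s = 4 * B ^ 2 := by
    have : T * 2 ^ s = 2 ^ b * 2 ^ b := by rw [hT, ← pow_add, ← pow_add]; congr 1; omega
    rw [this, eb]; ring
  have hB4 : 4 ≤ B := by
    simpa using Nat.pow_le_pow_right (n := 2) (by norm_num) (show 2 ≤ b - 1 by omega)
  have hTB : 4 * B ≤ T := by
    have : 4 * B = 2 ^ (b + 1) := by rw [pow_succ, eb]; ring
    rw [this]
    exact Nat.pow_le_pow_right (by norm_num) (by omega)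
  have hz : 2 ≤ 2 ^ z := by simpa using Nat.pow_le_pow_right (n := 2) (by norm_num) hz₁
  have hTz := Nat.mul_le_mul_left T hz
  -- Since `1 ≤ z`, the term `T * 2 ^ z` absorbs the `T` on the right and leaves another `T` to
  -- spare.
  have h1 : ℓ * (T - 1) + T + 1 ≤ 2 ^ m := by omega
  obtain ⟨T', hT'⟩ : ∃ T', T = T' + 1 := ⟨T - 1, by omega⟩
  rw [hT', Nat.add_sub_cancel] at h1
  have hS1 : 1 ≤ 2 ^ s := Nat.one_le_two_pow
  have em : 2 ^ (m + s + 1) = 2 * (2 ^ m * 2 ^ s) := by rw [pow_succ, pow_add]; ring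
  rw [em, eb]
  generalize 2 ^ m = M at *
  generalize 2 ^ s = S at *
  -- Here `S * T' = 4 * B ^ 2 - S ≥ 4 * B ^ 2 - B`.
  have hkey : B * (2 * B + 1) ≤ S * T' := by
    rw [hT'] at hTS
    nlinarith
  have h3 : B * (2 * B + 1) * ℓ ≤ S * (ℓ * T') := by
    calc B * (2 * B + 1) * ℓ ≤ S * T' * ℓ := Nat.mul_le_mul_right _ hkey
      _ = S * (ℓ * T') := by ring
  have h4 : S * (ℓ * T' + (T' + 1) + 1) ≤ S * M := Nat.mul_le_mul_left _ h1
  nlinarith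

end Parameters

end BinaryLRC

theorem theorem4 (b s m z ℓ : ℕ) (hb : 3 ≤ b) (hs₁ : 1 ≤ s) (hs : s < b) (hm : 4 * b ≤ m)
    (hz₁ : 1 ≤ z) (hz : z ≡ m [MOD (2 * b - s)]) (hzb : z ≤ b)
    (hℓ : ((2 : ℝ) ^ (m + s - 1) - 1) / (2 ^ (b - 1) * (2 ^ b + 1)) < ℓ)
    (hℓ' : (ℓ : ℝ) ≤
      ((2 : ℝ) ^ m - 2 ^ (2 * b - s) * (2 ^ z - 1) - 1) / (2 ^ (2 * b - s) - 1)) :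
    (∃ W : Fin ℓ → Submodule (ZMod 2) (Fin m → ZMod 2),
      BinaryLRC.IsPartialSpread (2 * b - s) W) ∧
    ∀ (A : Matrix (Fin s ⊕ Fin (2 * b - s)) (Fin (2 ^ b)) (ZMod 2)), BinaryLRC.IsDesired A →
    ∀ (W : Fin ℓ → Submodule (ZMod 2) (Fin m → ZMod 2)),
      BinaryLRC.IsPartialSpread (2 * b - s) W →
      ∀ (e : ∀ i, Module.Basis (Fin (2 * b - s)) (ZMod 2) (W i))
        (GU : Matrix (Fin s) (Fin s) (ZMod 2)), LinearIndependent (ZMod 2) GU.col →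
        Fintype.card (Fin ℓ × Fin (2 ^ b + 1)) = (2 ^ b + 1) * ℓ ∧
        (Module.finrank (ZMod 2) (BinaryLRC.spreadCode GU e A) : ℤ) =
          (2 ^ b + 1) * ℓ - ℓ - m - s ∧
        6 ≤ BinaryLRC.minDist (BinaryLRC.spreadCode GU e A) ∧
        BinaryLRC.HasLocality (BinaryLRC.spreadCode GU e A) (2 ^ b) ∧
        BinaryLRC.HasDisjointRepairGroups (BinaryLRC.spreadCode GU e A) (2 ^ b) ℓ ∧
        BinaryLRC.IsKOptimal (BinaryLRC.spreadCode GU e A) (2 ^ b) := by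
  have hlow := BinaryLRC.two_pow_le_of_div_lt hℓ
  have hup := BinaryLRC.mul_le_of_le_div (by omega) hℓ'
  have hlen := BinaryLRC.two_pow_le_length hb hs₁ hm hlow
  have hrl := BinaryLRC.mul_lt_two_pow_mul hb hs₁ hm hlen
  have hℓ4 : 4 ≤ ℓ := by
    have := BinaryLRC.four_mul_lt_two_pow (y := m + s - 1 - 2 * b) (by omega)
    omega
  have hr8 : 8 ≤ 2 ^ b := by simpa using Nat.pow_le_pow_right (n := 2) (by norm_num) hb
  constructor
  · obtain ⟨q, hq⟩ := (Nat.modEq_iff_dvd' (by omega : z ≤ m)).1 hz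
    -- If `q = 0` then `m = z ≤ b`, against `4 * b ≤ m`.
    have hq1 : 1 ≤ q := by
      rcases Nat.eq_zero_or_pos q with rfl | h
      · omega
      · exact h
    obtain rfl : m = q * (2 * b - s) + z := by rw [mul_comm]; omega
    obtain ⟨N, hN, hspread⟩ :=
      BinaryLRC.exists_hasPartialSpread (2 * b - s) z q (by omega) hq1
    have hlN : ℓ ≤ N := by
      have h2 : 2 ≤ 2 ^ (2 * b - s) := by
        simpa using Nat.pow_le_pow_right (n := 2) (by norm_num) (show 1 ≤ 2 * b - s by omega)
      exact Nat.le_of_mul_le_mul_right (by omega : ℓ * (2 ^ (2 * b - s) - 1) ≤ _)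
        (by omega : 0 < 2 ^ (2 * b - s) - 1)
    obtain ⟨W, hW, hd⟩ := hspread.mono hlN
    exact ⟨W, hW, fun i j hij => (hd i j hij).eq_bot⟩
  intro A hA W hW e GU hGU
  have htop := hW.iSup_eq_top (by omega) (BinaryLRC.two_pow_le_mul_of_lower hb hs hm hlow)
  have hdim := BinaryLRC.finrank_spreadCode (e := e) hA htop (by omega) hGU
  have hdimZ : (Module.finrank (ZMod 2) (BinaryLRC.spreadCode GU e A) : ℤ) =
      (2 ^ b + 1) * ℓ - ℓ - m - s := by
    have : (Module.finrank (ZMod 2) (BinaryLRC.spreadCode GU e A) : ℤ) + (ℓ + (s + m)) =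
      ℓ * (2 ^ b + 1) := by exact_mod_cast hdim
    linarith
  -- A zero code would force `2 ^ b * ℓ = m + s`, which `hrl` forbids.
  have hne : BinaryLRC.spreadCode GU e A ≠ ⊥ := by
    intro hbot
    rw [hbot, finrank_bot] at hdim
    nlinarith [show 1 ≤ m + s - 1 by omega, Nat.sub_add_cancel (show 1 ≤ m + s by omega)]
  have hdist : 6 ≤ BinaryLRC.minDist (BinaryLRC.spreadCode GU e A) :=
    BinaryLRC.le_minDist hne fun c hc hw =>
      BinaryLRC.eq_zero_of_mem_spreadCode hA (by omega) (by omega) hW hGU hc hw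
  refine ⟨by simp [mul_comm], hdimZ, hdist, BinaryLRC.hasLocality_spreadCode,
    BinaryLRC.hasDisjointRepairGroups_spreadCode,
    ⟨BinaryLRC.hasLocality_spreadCode, by omega, by omega, ?_, ?_⟩⟩
  · simp only [Fintype.card_prod, Fintype.card_fin]
    have h4 : (4 : ℝ) ≤ ℓ := by exact_mod_cast hℓ4
    have h8 : (8 : ℝ) ≤ 2 ^ b := by exact_mod_cast hr8
    push_cast
    nlinarith
  · have hsub : m + s - 1 + 1 = m + s := by omega
    have hpow : 2 ^ b = 2 * 2 ^ (b - 1) := by rw [← pow_succ']; congr 1; omega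
    simp only [Fintype.card_prod, Fintype.card_fin]
    rw [BinaryLRC.floor_dimBound (N := m + s - 1), hdimZ]
    · push_cast [Nat.cast_sub (show 1 ≤ m + s by omega)]
      ring
    -- This is `hlow` doubled; the summand 2 makes it strict.
    · rw [pow_succ]
      nth_rewrite 2 [hpow]
      nlinarith
    · rw [show m + s - 1 + 2 = m + s + 1 by omega]
      exact BinaryLRC.mul_add_two_le_two_pow hb hs hz₁ hup
    · exact hrl
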